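/- For $n\in\mathbb N$ and $f\colon\{-1,1\}^n\to\mathbb R$ write $\mathbb E[f]=2^{-n}\sum_{x\in\{-1,1\}^n} f(x)$, let $\hat f(S)=\mathbb E\big[f(x)\prod_{i\in S}x_i\big]$ for $S\subseteq\{1,\dots,n\}$ be the Fourier coefficients of $f$, and let $W^1(f)=\sum_{|S|=1}\hat f(S)^2$ be its first-degree Fourier weight. Let $\log$ denote the natural logarithm, with the convention $0^2\log(1/0)=0$. **Theorem.** There exists a universal constant $c>0$ such that for every $n$, every $a\in\mathbb R^n$ and every $t\in\mathbb R$, if the halfspace $f\colon\{-1,1\}^n\to\{0,1\}$, $f(x)=\mathbf 1\big(\sum_{i=1}^n a_i x_i>t\big)$, satisfies $\mathbb E[f]\le \frac12$, then $$c\,\mathbb E[f]^2\log\frac1{\mathbb E[f]}\;\le\; W^1(f)\;\le\; 2\,\mathbb E[f]^2\log\frac1{\mathbb E[f]}.$$ -/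

import Mathlib

open Finset
open scoped BigOperators

noncomputable section

/-- The discrete cube `{-1,1}^n`; the units of `ℤ` are exactly `1` and `-1`. -/
abbrev Cube (n : ℕ) : Type := Fin n → ℤˣ

/-- The expectation of a real function on the cube under the uniform distribution. -/
def cubeMean {n : ℕ} (f : Cube n → ℝ) : ℝ := 𝔼 x, f x

/-- The monomial `x^S = ∏_{i ∈ S} x_i`. -/
def monomialOn {n : ℕ} (S : Finset (Fin n)) (x : Cube n) : ℝ := ∏ i ∈ S, ((x i : ℤ) : ℝ)

/-- The Fourier coefficient of `f` at `S`, that is, the coefficient of `x^S` in the multilinear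
expansion of `f`. -/
def fourierCoefficient {n : ℕ} (f : Cube n → ℝ) (S : Finset (Fin n)) : ℝ :=
  cubeMean fun x => f x * monomialOn S x

/-- The degree-`k` Fourier weight `∑_{|S| = k} (fourierCoefficient f S)^2`. -/
def fourierWeight {n : ℕ} (k : ℕ) (f : Cube n → ℝ) : ℝ :=
  ∑ S ∈ powersetCard k (univ : Finset (Fin n)), fourierCoefficient f S ^ 2

/-- The `{0,1}`-valued function `1(∑ a_i x_i > t)` on the cube. -/
def halfspace {n : ℕ} (a : Fin n → ℝ) (t : ℝ) : Cube n → ℝ :=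
  fun x => if ∑ i, a i * ((x i : ℤ) : ℝ) > t then 1 else 0

end

/-! ### Expectation on the cube and independence of coordinates. -/

section CubeMean

variable {n : ℕ}

/-! Write α for the mean of f, W for its first-degree weight, and m for the mean vector of the
uniform measure conditioned on f = 1, so that W = α²|m|². The upper bound holds for every 0/1
function: Jensen on the support of f, against the subgaussian bound for ∑ m_i x_i, gives |m|² ≤ 2
log(1/α).

For the lower bound, m lies in the open halfspace. A product measure with mean essentially m
therefore gives the halfspace probability at least 1/11, by a fourth-moment argument, while its
density has squared L² norm at most exp(4|m|²). Cauchy–Schwarz then yields log(1/α) ≤ 4W/α² + log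
121 (`log_inv_cubeMean_halfspace_le`). The additive constant is absorbed by α² ≤ 256 W
(`sq_cubeMean_halfspace_le`), which is where α ≤ 1/2 enters. -/

lemma cubeMean_add (f g : Cube n → ℝ) :
    cubeMean (fun x => f x + g x) = cubeMean f + cubeMean g := expect_add_distrib _ _ _

lemma cubeMean_sub (f g : Cube n → ℝ) :
    cubeMean (fun x => f x - g x) = cubeMean f - cubeMean g := expect_sub_distrib _ _ _

lemma cubeMean_const_mul (c : ℝ) (f : Cube n → ℝ) :
    cubeMean (fun x => c * f x) = c * cubeMean f := (mul_expect _ _ _).symm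

lemma cubeMean_const (c : ℝ) : cubeMean (fun _ : Cube n => c) = c :=
  expect_const univ_nonempty c

lemma cubeMean_sum (F : Fin n → Cube n → ℝ) :
    cubeMean (fun x => ∑ i, F i x) = ∑ i, cubeMean (F i) := expect_sum_comm _ _ _

lemma cubeMean_mono {f g : Cube n → ℝ} (h : ∀ x, f x ≤ g x) : cubeMean f ≤ cubeMean g :=
  expect_le_expect fun x _ => h x

lemma cubeMean_nonneg {f : Cube n → ℝ} (h : ∀ x, 0 ≤ f x) : 0 ≤ cubeMean f :=
  expect_nonneg fun x _ => h x

lemma cubeMean_mul_sq_le (f g : Cube n → ℝ) :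
    cubeMean (fun x => f x * g x) ^ 2 ≤
      cubeMean (fun x => f x ^ 2) * cubeMean (fun x => g x ^ 2) :=
  expect_mul_sq_le_sq_mul_sq _ _ _

lemma cubeMean_zero_dim (f : Cube 0 → ℝ) : cubeMean f = f default := by
  have h : f = fun _ => f default := funext fun x => congrArg f (Subsingleton.elim _ _)
  rw [h, cubeMean_const]

lemma cubeMean_succ (f : Cube (n + 1) → ℝ) :
    cubeMean f = cubeMean (fun x : Cube n =>
      (f (Fin.cons 1 x : Cube (n + 1)) + f (Fin.cons (-1) x : Cube (n + 1))) / 2) := by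
  have key : ∑ x, f x = ∑ x : Cube n,
      (f (Fin.cons 1 x : Cube (n + 1)) + f (Fin.cons (-1) x : Cube (n + 1))) := by
    rw [← (Fin.consEquiv fun _ => ℤˣ).sum_comp, Fintype.sum_prod_type_right]
    refine sum_congr rfl fun x _ => ?_
    rw [UnitsInt.univ, sum_pair (by decide)]
    rfl
  simp only [cubeMean, Fintype.expect_eq_sum_div_card, key, ← sum_div]
  simp only [Fintype.card_pi, Fintype.card_units_int, prod_const, card_univ, Fintype.card_fin,
    Nat.cast_pow, Nat.cast_ofNat]
  field_simp
  ring

lemma cubeMean_prod (φ : Fin n → ℤˣ → ℝ) :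
    cubeMean (fun x => ∏ i, φ i (x i)) = ∏ i, (φ i 1 + φ i (-1)) / 2 := by
  induction n with
  | zero => simp [cubeMean_zero_dim]
  | succ n ih =>
    rw [cubeMean_succ, Fin.prod_univ_succ, ← ih, ← cubeMean_const_mul]
    congr 1
    ext x
    simp only [Fin.prod_univ_succ, Fin.cons_zero, Fin.cons_succ]
    ring

end CubeMean

/-! ### Product measures on the cube: moments and anticoncentration of linear forms. -/

section ProductMeasure

variable {n : ℕ}

/-- The density, with respect to the uniform measure, of the product measure on the cube with
mean vector `μ`. -/
def productDensity (μ : Fin n → ℝ) (x : Cube n) : ℝ := ∏ i, (1 + μ i * ((x i : ℤ) : ℝ))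

/-- The linear form `∑ a_i (x_i - μ_i)`. -/
def centeredForm (a μ : Fin n → ℝ) (x : Cube n) : ℝ := ∑ i, a i * (((x i : ℤ) : ℝ) - μ i)

lemma unit_cast_eq (e : ℤˣ) : ((e : ℤ) : ℝ) = 1 ∨ ((e : ℤ) : ℝ) = -1 := by
  rcases Int.units_eq_one_or e with rfl | rfl <;> simp

lemma productDensity_nonneg {μ : Fin n → ℝ} (h : ∀ i, |μ i| ≤ 1) (x : Cube n) :
    0 ≤ productDensity μ x := by
  refine prod_nonneg fun i _ => ?_
  have := abs_le.1 (h i)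
  rcases unit_cast_eq (x i) with e | e <;> rw [e] <;> linarith

lemma cubeMean_productDensity (μ : Fin n → ℝ) : cubeMean (productDensity μ) = 1 := by
  have := cubeMean_prod fun i (e : ℤˣ) => 1 + μ i * ((e : ℤ) : ℝ)
  refine this.trans (prod_eq_one fun i _ => ?_)
  push_cast
  ring

lemma cubeMean_productDensity_sq_le (μ : Fin n → ℝ) :
    cubeMean (fun x => productDensity μ x ^ 2) ≤ Real.exp (∑ i, μ i ^ 2) := by
  simp only [productDensity, ← prod_pow]
  have := cubeMean_prod fun i (e : ℤˣ) => (1 + μ i * ((e : ℤ) : ℝ)) ^ 2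
  rw [this, Real.exp_sum]
  refine prod_le_prod (fun i _ => by positivity) fun i _ => ?_
  have := Real.add_one_le_exp (μ i ^ 2)
  push_cast
  linarith

lemma productDensity_cons (μ : Fin (n + 1) → ℝ) (e : ℤˣ) (x : Cube n) :
    productDensity μ (Fin.cons e x : Cube (n + 1)) =
      (1 + μ 0 * ((e : ℤ) : ℝ)) * productDensity (fun i => μ i.succ) x := by
  simp [productDensity, Fin.prod_univ_succ]

lemma centeredForm_cons (a μ : Fin (n + 1) → ℝ) (e : ℤˣ) (x : Cube n) :
    centeredForm a μ (Fin.cons e x : Cube (n + 1)) =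
      a 0 * (((e : ℤ) : ℝ) - μ 0) + centeredForm (fun i => a i.succ) (fun i => μ i.succ) x := by
  simp [centeredForm, Fin.sum_univ_succ]

lemma cubeMean_productDensity_mul_centeredForm (a μ : Fin n → ℝ) :
    cubeMean (fun x => productDensity μ x * centeredForm a μ x) = 0 := by
  induction n with
  | zero => simp [cubeMean_zero_dim, centeredForm]
  | succ n ih =>
    rw [cubeMean_succ, ← ih (fun i => a i.succ) (fun i => μ i.succ)]
    congr 1
    ext x
    simp only [productDensity_cons, centeredForm_cons]
    push_cast
    ring

lemma cubeMean_productDensity_mul_centeredForm_sq (a μ : Fin n → ℝ) :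
    cubeMean (fun x => productDensity μ x * centeredForm a μ x ^ 2) =
      ∑ i, a i ^ 2 * (1 - μ i ^ 2) := by
  induction n with
  | zero => simp [cubeMean_zero_dim, centeredForm]
  | succ n ih =>
    rw [cubeMean_succ, Fin.sum_univ_succ, ← ih (fun i => a i.succ) (fun i => μ i.succ)]
    have h := cubeMean_productDensity fun i : Fin n => μ i.succ
    have hc : a 0 ^ 2 * (1 - μ 0 ^ 2) = cubeMean fun x =>
        a 0 ^ 2 * (1 - μ 0 ^ 2) * productDensity (fun i : Fin n => μ i.succ) x := by
      rw [cubeMean_const_mul, h, mul_one]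
    rw [hc, ← cubeMean_add]
    congr 1
    ext x
    simp only [productDensity_cons, centeredForm_cons]
    push_cast
    ring

/-- If every coordinate is either deterministic or has mean at most `1/2` in absolute value, the
kurtosis of a linear form under the product measure is at most `3`. -/
lemma cubeMean_productDensity_mul_centeredForm_pow_four_le (a μ : Fin n → ℝ)
    (hμ : ∀ i, μ i ^ 2 = 1 ∨ μ i ^ 2 ≤ 1 / 4) :
    cubeMean (fun x => productDensity μ x * centeredForm a μ x ^ 4) ≤
      3 * (∑ i, a i ^ 2 * (1 - μ i ^ 2)) ^ 2 := by
  induction n with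
  | zero => simp [cubeMean_zero_dim, centeredForm]
  | succ n ih =>
    have ih := ih (fun i => a i.succ) (fun i => μ i.succ) fun i => hμ i.succ
    rw [cubeMean_succ, Fin.sum_univ_succ]
    have h0 := cubeMean_productDensity fun i : Fin n => μ i.succ
    have h1 := cubeMean_productDensity_mul_centeredForm
      (fun i : Fin n => a i.succ) (fun i => μ i.succ)
    have h2 := cubeMean_productDensity_mul_centeredForm_sq
      (fun i : Fin n => a i.succ) (fun i => μ i.succ)
    set h := productDensity fun i : Fin n => μ i.succ
    set Z := centeredForm (fun i : Fin n => a i.succ) fun i => μ i.succ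
    set A := a 0
    set m := μ 0 with hm
    -- Average over the first coordinate. The coefficients come from its centred moments 1 - m²,
    -- -2m(1 - m²) and (1 - m²)(1 + 3m²); the Z³ term drops out.
    have key : (fun x : Cube n =>
        (productDensity μ (Fin.cons 1 x : Cube (n + 1)) *
            centeredForm a μ (Fin.cons 1 x : Cube (n + 1)) ^ 4 +
          productDensity μ (Fin.cons (-1) x : Cube (n + 1)) *
            centeredForm a μ (Fin.cons (-1) x : Cube (n + 1)) ^ 4) / 2) =
        fun x => (h x * Z x ^ 4 + 6 * A ^ 2 * (1 - m ^ 2) * (h x * Z x ^ 2)) +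
          (-8 * A ^ 3 * m * (1 - m ^ 2) * (h x * Z x) +
            A ^ 4 * ((1 - m ^ 2) * (1 + 3 * m ^ 2)) * h x) := by
      ext x
      simp only [productDensity_cons, centeredForm_cons]
      push_cast
      ring
    rw [key, cubeMean_add, cubeMean_add, cubeMean_add, cubeMean_const_mul, cubeMean_const_mul,
      cubeMean_const_mul, h0, h1, h2]
    -- For m² < 1 this asks for m² ≤ 1/3: the kurtosis of one coordinate blows up as |m| → 1, but a
    -- deterministic coordinate contributes nothing.
    have hk : A ^ 4 * ((1 - m ^ 2) * (1 + 3 * m ^ 2)) ≤ A ^ 4 * (3 * (1 - m ^ 2) ^ 2) := by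
      refine mul_le_mul_of_nonneg_left ?_ (by positivity)
      rcases hμ 0 with e | e
      · rw [← hm] at e
        simp [e]
      · rw [← hm] at e
        nlinarith
    nlinarith

/-- If every coordinate is either deterministic or has mean at most `1/2` in absolute value, a
linear form reaches its mean with probability at least `1/11`. -/
lemma cubeMean_productDensity_mul_indicator_nonneg_ge (a μ : Fin n → ℝ)
    (hμ1 : ∀ i, |μ i| ≤ 1) (hμ : ∀ i, μ i ^ 2 = 1 ∨ μ i ^ 2 ≤ 1 / 4) :
    1 / 11 ≤ cubeMean (fun x => productDensity μ x * if 0 ≤ centeredForm a μ x then 1 else 0) := by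
  have h0 := cubeMean_productDensity μ
  have h1 := cubeMean_productDensity_mul_centeredForm a μ
  have h2 := cubeMean_productDensity_mul_centeredForm_sq a μ
  have h4 := cubeMean_productDensity_mul_centeredForm_pow_four_le a μ hμ
  have hpos := productDensity_nonneg hμ1
  set V := ∑ i, a i ^ 2 * (1 - μ i ^ 2) with hV
  have hV0 : 0 ≤ V := h2 ▸ cubeMean_nonneg fun x => mul_nonneg (hpos x) (sq_nonneg _)
  set h := productDensity μ
  set Z := centeredForm a μ
  rcases hV0.eq_or_lt with hz | hVpos
  -- Zero variance: Z vanishes wherever the density does not, so the probability is 1.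
  · have hle : cubeMean h ≤
        cubeMean (fun x => h x * if 0 ≤ Z x then 1 else 0) := by
      have hsum : ∑ x, h x * Z x ^ 2 = 0 := by
        rw [← hz, cubeMean, Fintype.expect_eq_sum_div_card] at h2
        rcases div_eq_zero_iff.1 h2 with h3 | h3
        · exact h3
        · exact absurd h3 (by simp)
      have hall := (sum_eq_zero_iff_of_nonneg
        fun x _ => mul_nonneg (hpos x) (sq_nonneg (Z x))).1 hsum
      refine cubeMean_mono fun x => ?_
      rcases mul_eq_zero.1 (hall x (mem_univ x)) with e | e
      · simp [e]
      · simp [pow_eq_zero_iff (two_ne_zero) |>.1 e]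
    linarith
  · obtain ⟨s, hs, hsV⟩ : ∃ s, 0 < s ∧ s ^ 2 = V :=
      ⟨√V, Real.sqrt_pos.2 hVpos, Real.sq_sqrt hV0⟩
    -- A quartic minorant of the indicator. By the moment bounds its left side has mean at least (0
    -- + 4 - 3)s⁴, whence 1/11.
    have hpt : ∀ z : ℝ, 4 * z * s ^ 3 + 4 * z ^ 2 * s ^ 2 - z ^ 4 ≤
        11 * s ^ 4 * if 0 ≤ z then 1 else 0 := by
      intro z
      obtain ⟨u, rfl⟩ : ∃ u, z = u * s := ⟨z / s, by field_simp⟩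
      have hs4 : 0 < s ^ 4 := by positivity
      split_ifs with hz
      · have hu : 0 ≤ u := nonneg_of_mul_nonneg_left hz hs
        have : 4 * u + 4 * u ^ 2 - u ^ 4 ≤ 11 := by
          nlinarith [sq_nonneg (u ^ 2 - 27 / 10), sq_nonneg (u - 17 / 10)]
        nlinarith
      · have hu : u < 0 := by
          by_contra! hc
          exact hz (by positivity)
        have : 4 + 4 * u - u ^ 3 ≥ 0 := by
          nlinarith [mul_nonneg (neg_nonneg.2 hu.le) (sq_nonneg (u + 1)), sq_nonneg (u + 1),
            mul_nonneg (neg_nonneg.2 hu.le) (sq_nonneg (u + 6 / 5)), sq_nonneg (u + 6 / 5)]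
        have : u * (4 + 4 * u - u ^ 3) ≤ 0 := mul_nonpos_of_nonpos_of_nonneg hu.le this
        nlinarith
    have hmono := cubeMean_mono (n := n) fun x => mul_le_mul_of_nonneg_left (hpt (Z x)) (hpos x)
    have e1 : (fun x => h x * (4 * Z x * s ^ 3 + 4 * Z x ^ 2 * s ^ 2 - Z x ^ 4)) =
        fun x => (4 * s ^ 3 * (h x * Z x) + 4 * s ^ 2 * (h x * Z x ^ 2)) - h x * Z x ^ 4 := by
      ext x
      ring
    have e2 : (fun x => h x * (11 * s ^ 4 * if 0 ≤ Z x then 1 else 0)) =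
        fun x => 11 * s ^ 4 * (h x * if 0 ≤ Z x then 1 else 0) := by
      ext x
      ring
    rw [e1, e2, cubeMean_sub, cubeMean_add, cubeMean_const_mul, cubeMean_const_mul,
      cubeMean_const_mul, h1, h2] at hmono
    rw [← hsV] at h4 hmono
    have hs4 : 0 < s ^ 4 := by positivity
    have : s ^ 4 * 1 ≤
        s ^ 4 * (11 * cubeMean fun x => h x * if 0 ≤ Z x then 1 else 0) := by nlinarith
    have := le_of_mul_le_mul_left this hs4
    linarith

end ProductMeasure

/-! ### The upper bound. -/

section FirstLevel

variable {n : ℕ}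

lemma fourierWeight_one (f : Cube n → ℝ) :
    fourierWeight 1 f = ∑ i, cubeMean (fun x => f x * ((x i : ℤ) : ℝ)) ^ 2 := by
  simp [fourierWeight, powersetCard_one, fourierCoefficient, monomialOn]

lemma cubeMean_mul_linear (f : Cube n → ℝ) (a : Fin n → ℝ) :
    cubeMean (fun x => f x * ∑ i, a i * ((x i : ℤ) : ℝ)) =
      ∑ i, a i * cubeMean (fun x => f x * ((x i : ℤ) : ℝ)) := by
  simp only [← cubeMean_const_mul, ← cubeMean_sum]
  congr 1
  ext x
  rw [mul_sum]
  exact sum_congr rfl fun i _ => by ring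

lemma cubeMean_exp_linear_le (a : Fin n → ℝ) :
    cubeMean (fun x => Real.exp (∑ i, a i * ((x i : ℤ) : ℝ))) ≤
      Real.exp (∑ i, a i ^ 2 / 2) := by
  simp only [Real.exp_sum]
  have := cubeMean_prod fun i (e : ℤˣ) => Real.exp (a i * ((e : ℤ) : ℝ))
  rw [this]
  refine prod_le_prod (fun i _ => by positivity) fun i _ => ?_
  have := Real.cosh_le_exp_half_sq (a i)
  rw [Real.cosh_eq] at this
  simpa using this

/-- The level-one inequality. -/
lemma fourierWeight_one_le (f : Cube n → ℝ) (hf : ∀ x, f x = 0 ∨ f x = 1) :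
    fourierWeight 1 f ≤ 2 * cubeMean f ^ 2 * Real.log (1 / cubeMean f) := by
  have hf0 : ∀ x, 0 ≤ f x := fun x => by rcases hf x with e | e <;> simp [e]
  -- If the mean is 0, Cauchy–Schwarz kills every coefficient.
  rcases (cubeMean_nonneg hf0).eq_or_lt with hz | hα
  · have hsq := fun i => cubeMean_mul_sq_le f fun x : Cube n => ((x i : ℤ) : ℝ)
    have hff : (fun x => f x ^ 2) = f := by
      ext x
      rcases hf x with e | e <;> simp [e]
    simp only [hff, ← hz, zero_mul] at hsq
    rw [fourierWeight_one, ← hz]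
    simpa using sum_nonpos fun i (_ : i ∈ univ) => hsq i
  · rw [fourierWeight_one]
    set α := cubeMean f
    set b := fun i => cubeMean (fun x => f x * ((x i : ℤ) : ℝ))
    set W := ∑ i, b i ^ 2
    have hlin := cubeMean_mul_linear f fun i => b i / α
    have hlinW : ∑ i, b i / α * b i = W / α := by
      rw [sum_div]
      exact sum_congr rfl fun i _ => by ring
    rw [hlinW] at hlin
    have hexp := cubeMean_exp_linear_le fun i => b i / α
    have hexpW : ∑ i, (b i / α) ^ 2 / 2 = W / (2 * α ^ 2) := by
      rw [sum_div]
      exact sum_congr rfl fun i _ => by field_simp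
    rw [hexpW] at hexp
    set g := fun x : Cube n => ∑ i, b i / α * ((x i : ℤ) : ℝ)
    -- Tangent line of `exp` at the conditional mean `W / α ^ 2` of `g` on the support of `f`.
    set c := W / α ^ 2 with hc
    have hpt : ∀ x, Real.exp c * ((1 - c) * f x + f x * g x) ≤ Real.exp (g x) := by
      intro x
      rcases hf x with e | e
      · simp [e, Real.exp_nonneg]
      · have := Real.add_one_le_exp (g x - c)
        have h2 : Real.exp (g x) = Real.exp c * Real.exp (g x - c) := by
          rw [← Real.exp_add]
          congr 1
          ring
        rw [e, h2]
        exact mul_le_mul_of_nonneg_left (by linarith) (Real.exp_nonneg _)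
    have hm := cubeMean_mono hpt
    rw [cubeMean_const_mul, cubeMean_add, cubeMean_const_mul, hlin] at hm
    have hval : (1 - c) * cubeMean f + W / α = α := by
      rw [hc]
      field_simp
      ring
    rw [hval] at hm
    have hle := hm.trans hexp
    have hlog := Real.log_le_log (by positivity) hle
    rw [Real.log_mul (Real.exp_ne_zero _) hα.ne', Real.log_exp, Real.log_exp] at hlog
    rw [one_div, Real.log_inv]
    have hW : W = c * α ^ 2 := by
      rw [hc]
      field_simp
    have : W / (2 * α ^ 2) = c / 2 := by
      rw [hc]
      field_simp
    rw [this] at hlog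
    rw [hW]
    nlinarith [sq_pos_of_pos hα]

end FirstLevel

/-! ### The lower bound for halfspaces. -/

section Halfspace

variable {n : ℕ}

lemma halfspace_eq_zero_or_one (a : Fin n → ℝ) (t : ℝ) (x : Cube n) :
    halfspace a t x = 0 ∨ halfspace a t x = 1 := by
  unfold halfspace
  split_ifs <;> simp

/-- A Khintchine inequality from the second and fourth moments, by integrating 4s²z² - z⁴ ≤ 4s³|z|.
-/
lemma cubeMean_abs_linear_ge (a : Fin n → ℝ) :
    √(∑ i, a i ^ 2) / 4 ≤ cubeMean (fun x => |∑ i, a i * ((x i : ℤ) : ℝ)|) := by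
  have h2 := cubeMean_productDensity_mul_centeredForm_sq a 0
  have h4 := cubeMean_productDensity_mul_centeredForm_pow_four_le a 0 (by simp)
  simp only [productDensity, centeredForm, Pi.zero_apply, zero_mul, add_zero, prod_const_one,
    one_mul, sub_zero, ne_eq, OfNat.ofNat_ne_zero, not_false_eq_true, zero_pow, mul_one] at h2 h4
  have hV0 : 0 ≤ ∑ i, a i ^ 2 := sum_nonneg fun i _ => sq_nonneg _
  set s := √(∑ i, a i ^ 2)
  rw [← Real.sq_sqrt hV0] at h2 h4
  rcases (Real.sqrt_nonneg (∑ i, a i ^ 2)).eq_or_lt with hz | hs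
  · rw [show s = 0 from hz.symm, zero_div]
    exact cubeMean_nonneg fun x => abs_nonneg _
  · change 0 < s at hs
    have hpt : ∀ z : ℝ, 4 * s ^ 2 * z ^ 2 - z ^ 4 ≤ 4 * s ^ 3 * |z| := by
      intro z
      rw [← sq_abs z, ← (show Even 4 by decide).pow_abs z]
      obtain ⟨u, hu⟩ : ∃ u, |z| = u * s := ⟨|z| / s, by field_simp⟩
      have hu0 : 0 ≤ u := nonneg_of_mul_nonneg_left (hu ▸ abs_nonneg z) hs
      rw [hu]
      have : 0 ≤ 4 - 4 * u + u ^ 3 := by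
        nlinarith [mul_nonneg hu0 (sq_nonneg (u - 6 / 5)), sq_nonneg (u - 6 / 5)]
      have : 0 ≤ s ^ 4 * (u * (4 - 4 * u + u ^ 3)) := by positivity
      nlinarith
    have hm := cubeMean_mono (n := n) fun x => hpt (∑ i, a i * ((x i : ℤ) : ℝ))
    rw [cubeMean_sub, cubeMean_const_mul, cubeMean_const_mul, h2] at hm
    have : s ^ 3 * (s / 4) ≤
        s ^ 3 * cubeMean (fun x => |∑ i, a i * ((x i : ℤ) : ℝ)|) := by nlinarith
    exact le_of_mul_le_mul_left this (by positivity)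

lemma cubeMean_linear (a : Fin n → ℝ) :
    cubeMean (fun x => ∑ i, a i * ((x i : ℤ) : ℝ)) = 0 := by
  have := cubeMean_productDensity_mul_centeredForm a 0
  simpa [productDensity, centeredForm] using this

lemma cubeMean_halfspace_mul_linear_ge (a : Fin n → ℝ) (t : ℝ)
    (h : cubeMean (halfspace a t) ≤ 1 / 2) :
    √(∑ i, a i ^ 2) / 16 * cubeMean (halfspace a t) ≤
      cubeMean (fun x => halfspace a t x * ∑ i, a i * ((x i : ℤ) : ℝ)) := by
  have h1 := cubeMean_abs_linear_ge a
  have h0 := cubeMean_linear a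
  set τ := √(∑ i, a i ^ 2) / 16 with hτ
  have hτ0 : 0 ≤ τ := by positivity
  have hdef : ∀ x, halfspace a t x = if ∑ i, a i * ((x i : ℤ) : ℝ) > t then 1 else 0 :=
    fun x => rfl
  set f := halfspace a t
  set g := fun x : Cube n => ∑ i, a i * ((x i : ℤ) : ℝ) with hg
  change cubeMean g = 0 at h0
  -- If t > τ, the form exceeds τ on the halfspace. If t < -τ, it is below -τ off the halfspace,
  -- which has mass at least 1/2. If |t| ≤ τ, then f g ≥ g⁺ - τ, and g⁺ has mean at least 2τ.
  rcases lt_or_ge τ t with ht | ht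
  · rw [← cubeMean_const_mul]
    refine cubeMean_mono fun x => ?_
    rw [hdef x]
    split_ifs with hx
    · simp only [mul_one, one_mul]
      linarith
    · simp
  rcases lt_or_ge t (-τ) with ht' | ht'
  · have hpt : ∀ x, g x + τ * (1 - f x) ≤ f x * g x := by
      intro x
      rw [hdef x]
      split_ifs with hx
      · simp
      · change ¬ g x > t at hx
        simp only [zero_mul, sub_zero, mul_one]
        linarith
    have hm := cubeMean_mono hpt
    rw [cubeMean_add, cubeMean_const_mul, cubeMean_sub, cubeMean_const, h0] at hm
    nlinarith
  · have hpt : ∀ x, 1 / 2 * g x + 1 / 2 * |g x| - τ ≤ f x * g x := by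
      intro x
      rw [hdef x]
      split_ifs with hx
      · change g x > t at hx
        rcases abs_cases (g x) with e | e <;> linarith
      · change ¬ g x > t at hx
        rcases abs_cases (g x) with e | e <;> linarith
    have hm := cubeMean_mono hpt
    rw [cubeMean_sub, cubeMean_add, cubeMean_const_mul, cubeMean_const_mul, cubeMean_const,
      h0] at hm
    change _ ≤ cubeMean fun x => |g x| at h1
    nlinarith

lemma sq_cubeMean_halfspace_le (a : Fin n → ℝ) (t : ℝ)
    (h : cubeMean (halfspace a t) ≤ 1 / 2) :
    cubeMean (halfspace a t) ^ 2 ≤ 256 * fourierWeight 1 (halfspace a t) := by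
  have hge := cubeMean_halfspace_mul_linear_ge a t h
  rw [cubeMean_mul_linear] at hge
  rw [fourierWeight_one]
  have hα0 : 0 ≤ cubeMean (halfspace a t) := cubeMean_nonneg fun x => by
    rcases halfspace_eq_zero_or_one a t x with e | e <;> simp [e]
  have hCS := sum_mul_sq_le_sq_mul_sq univ a
    fun i => cubeMean (fun x => halfspace a t x * ((x i : ℤ) : ℝ))
  have hV0 : 0 ≤ ∑ i, a i ^ 2 := sum_nonneg fun i _ => sq_nonneg _
  -- If a = 0 the halfspace is constant, and mean at most 1/2 forces it to be empty.
  rcases hV0.eq_or_lt with hz | hV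
  · have ha : ∀ i, a i = 0 := fun i =>
      pow_eq_zero_iff two_ne_zero |>.1
        ((sum_eq_zero_iff_of_nonneg fun i _ => sq_nonneg (a i)).1 hz.symm i (mem_univ i))
    have hc : cubeMean (halfspace a t) = if 0 > t then 1 else 0 := by
      unfold halfspace
      simp only [ha, zero_mul, sum_const_zero, cubeMean_const]
    have hα : cubeMean (halfspace a t) = 0 := by
      rw [hc] at h ⊢
      split_ifs at h ⊢
      · norm_num at h
      · rfl
    rw [hα]
    have := sum_nonneg fun i (_ : i ∈ univ) =>
      sq_nonneg (cubeMean (fun x => halfspace a t x * ((x i : ℤ) : ℝ)))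
    linarith
  · have hsq := pow_le_pow_left₀ (by positivity) hge 2
    have := hsq.trans hCS
    rw [mul_pow, div_pow, Real.sq_sqrt hV0] at this
    refine le_of_mul_le_mul_left ?_ hV
    linarith

/-- Compare the uniform measure with the product measure whose mean vector is the conditional mean
vector of the halfspace, with its large coordinates rounded to `±1`. -/
lemma log_inv_cubeMean_halfspace_le (a : Fin n → ℝ) (t : ℝ)
    (hα : 0 < cubeMean (halfspace a t)) :
    Real.log (1 / cubeMean (halfspace a t)) ≤
      4 * (fourierWeight 1 (halfspace a t) / cubeMean (halfspace a t) ^ 2) + Real.log 121 := by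
  have h01 := halfspace_eq_zero_or_one a t
  have hdef : ∀ x, halfspace a t x = if ∑ i, a i * ((x i : ℤ) : ℝ) > t then 1 else 0 :=
    fun x => rfl
  have hlin := cubeMean_mul_linear (halfspace a t) a
  rw [fourierWeight_one]
  set f := halfspace a t
  set α := cubeMean f
  set b := fun i => cubeMean (fun x => f x * ((x i : ℤ) : ℝ))
  have hf0 : ∀ x, 0 ≤ f x := fun x => by rcases h01 x with e | e <;> simp [e]
  have hb : ∀ i, |b i| ≤ α := by
    intro i
    have hpt : ∀ x, |f x * ((x i : ℤ) : ℝ)| ≤ f x := by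
      intro x
      rw [abs_mul, abs_of_nonneg (hf0 x)]
      rcases unit_cast_eq (x i) with e | e <;> simp [e]
    refine abs_le.2 ⟨?_, cubeMean_mono fun x => (abs_le.1 (hpt x)).2⟩
    have := cubeMean_mono fun x => (show (-1) * f x ≤ f x * ((x i : ℤ) : ℝ) by
      linarith [(abs_le.1 (hpt x)).1])
    rw [cubeMean_const_mul] at this
    change (-1) * α ≤ b i at this
    linarith
  have hm1 : ∀ i, |b i / α| ≤ 1 := fun i => by
    rw [abs_div, abs_of_pos hα, div_le_one hα]
    exact hb i
  -- Rounding keeps the kurtosis bounded. Following the sign of a_i, it can only increase ∑ a_i μ_i;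
  -- from modulus at least 1/2 to 1, it multiplies a square by at most 4.
  set μ : Fin n → ℝ := fun i =>
    if 1 / 2 ≤ |b i / α| then (if 0 ≤ a i then 1 else -1) else b i / α with hμ
  have hμ1 : ∀ i, |μ i| ≤ 1 := by
    intro i
    simp only [hμ]
    split_ifs
    · simp
    · simp
    · exact hm1 i
  have hμ2 : ∀ i, μ i ^ 2 = 1 ∨ μ i ^ 2 ≤ 1 / 4 := by
    intro i
    simp only [hμ]
    split_ifs with h1 h2
    · simp
    · simp
    · right
      rw [← sq_abs]
      nlinarith [abs_nonneg (b i / α)]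
  have hμ3 : ∀ i, μ i ^ 2 ≤ 4 * (b i / α) ^ 2 := by
    intro i
    simp only [hμ]
    rw [← sq_abs (b i / α)]
    split_ifs with h1 h2
    · nlinarith
    · nlinarith
    · rw [← sq_abs (b i / α)]
      nlinarith [sq_nonneg (|b i / α|)]
  have hμa : ∀ i, a i * (b i / α) ≤ a i * μ i := by
    intro i
    have := abs_le.1 (hm1 i)
    simp only [hμ]
    split_ifs with h1 h2
    · nlinarith
    · nlinarith
    · exact le_rfl
  have hmean : t < ∑ i, a i * μ i := by
    have hlt : t * α < ∑ i, a i * b i := by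
      rw [← hlin, ← cubeMean_const_mul]
      obtain ⟨x₀, hx₀⟩ : ∃ x, f x ≠ 0 := by
        by_contra! hc
        exact hα.ne' ((congrArg cubeMean (funext hc)).trans (cubeMean_const 0))
      refine expect_lt_expect (fun x _ => ?_) ⟨x₀, mem_univ _, ?_⟩
      · rw [hdef x]
        split_ifs with hx
        · simp only [mul_one, one_mul]
          exact hx.le
        · simp
      · rw [hdef x₀] at hx₀ ⊢
        split_ifs at hx₀ ⊢ with hx
        · simp only [mul_one, one_mul]
          exact hx
        · simp at hx₀
    have : ∑ i, a i * (b i / α) = (∑ i, a i * b i) / α := by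
      rw [sum_div]
      exact sum_congr rfl fun i _ => by ring
    calc t < (∑ i, a i * b i) / α := (lt_div_iff₀ hα).2 hlt
      _ = ∑ i, a i * (b i / α) := this.symm
      _ ≤ _ := sum_le_sum fun i _ => hμa i
  have hp : 1 / 11 ≤ cubeMean (fun x => productDensity μ x * f x) := by
    refine (cubeMean_productDensity_mul_indicator_nonneg_ge a μ hμ1 hμ2).trans
      (cubeMean_mono fun x => mul_le_mul_of_nonneg_left ?_ (productDensity_nonneg hμ1 x))
    split_ifs with hx
    · have hgt : ∑ i, a i * ((x i : ℤ) : ℝ) > t := by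
        simp only [centeredForm, mul_sub, sum_sub_distrib] at hx
        linarith
      rw [hdef x, if_pos hgt]
    · exact hf0 x
  -- Change of measure: a set with probability at least 1/11 under a density of small L² norm cannot
  -- have small uniform measure.
  have hCS := cubeMean_mul_sq_le (productDensity μ) f
  have hff : (fun x => f x ^ 2) = f := by
    ext x
    rcases h01 x with e | e <;> simp [e]
  rw [hff] at hCS
  have hE : cubeMean (fun x => productDensity μ x ^ 2) ≤
      Real.exp (4 * ((∑ i, b i ^ 2) / α ^ 2)) := by
    refine (cubeMean_productDensity_sq_le μ).trans (Real.exp_le_exp.2 ?_)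
    rw [sum_div, mul_sum]
    exact sum_le_sum fun i _ => by rw [← div_pow]; exact hμ3 i
  have hfin : 1 / α ≤ Real.exp (4 * ((∑ i, b i ^ 2) / α ^ 2)) * 121 := by
    rw [div_le_iff₀ hα]
    have := mul_le_mul_of_nonneg_right hE hα.le
    have : (1 / 11 : ℝ) ^ 2 ≤ cubeMean (fun x => productDensity μ x * f x) ^ 2 :=
      pow_le_pow_left₀ (by norm_num) hp 2
    change _ ≤ _ * α at hCS
    linarith
  have := Real.log_le_log (by positivity) hfin
  rwa [Real.log_mul (Real.exp_ne_zero _) (by norm_num), Real.log_exp] at this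

lemma log_121_le : Real.log 121 ≤ 5 := by
  have h2 := Real.log_two_lt_d9
  have : Real.log 121 ≤ Real.log (2 ^ 7) := Real.log_le_log (by norm_num) (by norm_num)
  rw [Real.log_pow] at this
  push_cast at this
  linarith

end Halfspace

theorem theorem1 :
    ∃ c : ℝ, 0 < c ∧ ∀ (n : ℕ) (a : Fin n → ℝ) (t : ℝ),
      cubeMean (halfspace a t) ≤ 1 / 2 →
        c * cubeMean (halfspace a t) ^ 2 * Real.log (1 / cubeMean (halfspace a t))
            ≤ fourierWeight 1 (halfspace a t) ∧
          fourierWeight 1 (halfspace a t)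
            ≤ 2 * cubeMean (halfspace a t) ^ 2 * Real.log (1 / cubeMean (halfspace a t)) := by
  -- 1284 = 4 + 5 · 256, with 5 bounding log 121.
  refine ⟨1 / 1284, by norm_num, fun n a t h =>
    ⟨?_, fourierWeight_one_le _ (halfspace_eq_zero_or_one a t)⟩⟩
  have hα0 : 0 ≤ cubeMean (halfspace a t) := cubeMean_nonneg fun x => by
    rcases halfspace_eq_zero_or_one a t x with e | e <;> simp [e]
  rcases hα0.eq_or_lt with hz | hα
  · rw [← hz]
    simpa [fourierWeight] using sum_nonneg fun S (_ : S ∈ powersetCard 1 univ) =>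
      sq_nonneg (fourierCoefficient (halfspace a t) S)
  · have h1 := sq_cubeMean_halfspace_le a t h
    have h2 := log_inv_cubeMean_halfspace_le a t hα
    have h3 := log_121_le
    have hsq : 0 < cubeMean (halfspace a t) ^ 2 := by positivity
    have h4 := mul_le_mul_of_nonneg_left h2 hsq.le
    rw [mul_add, mul_left_comm, mul_div_cancel₀ _ hsq.ne'] at h4
    nlinarith
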